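/- Let $m\ge 1$ be an integer, $a\in\mathbb C\setminus\{0\}$ and $f(z)=z+az^{m+1}$ on $\mathbb C$. Let $\mathbf v$ be an attraction vector of $f$ at $0$, i.e. $\mathbf v\in\mathbb C$ with $m a\mathbf v^m=-1$. Say that the orbit of $z$ tends to $0$ from the direction $\mathbf v$ if $f^k(z)\to 0$ and $f^k(z)\sim \mathbf v/k^{1/m}$ as $k\to\infty$; let $\mathcal A$ be the set of all $z\in\mathbb C$ with this property (the parabolic basin of $\mathbf v$), and let $\Omega$ be the immediate basin, i.e. the connected component of $\mathcal A$ that $f$ maps into itself. Let $\mathcal P$ be an attracting petal for $\mathbf v$: an open set, contained in an open neighbourhood of $0$ on which $f$ is univalent, such that $f(\mathcal P)\subseteq\mathcal P$ and such that an orbit of $f$ is eventually contained in $\mathcal P$ if and only if it tends to $0$ from the direction $\mathbf v$. Then for every constant $C>0$ and every point $q\in\mathcal P$ on the open ray $\{s\mathbf v: s>0\}$ there is a point $z_0\in\Omega$ such that $$d_\Omega(z_0,\tilde q)\ge C\qquad\text{for every }\ \tilde q\in Q:=\Big(\bigcup_{l,k\ge 0} f^{-l}\big(f^k(q)\big)\Big)\cap\Omega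 .$$ Here $d_\Omega$ is the Kobayashi distance of $\Omega$: with $\Delta$ the unit disk and $$F_\Omega(z,\xi)=\inf\{\lambda>0:\ \exists\, g:\Delta\to\Omega \text{ holomorphic},\ g(0)=z,\ \lambda g'(0)=\xi\},$$ $d_\Omega(z,w)$ is the infimum of $\int_0^1F_\Omega(\gamma(t),\gamma'(t))\,dt$ over all piecewise continuously differentiable curves $\gamma:[0,1]\to\Omega$ from $z$ to $w$. -/

import Mathlib

open Filter Topology Set Asymptotics MeasureTheory
open scoped ENNReal

/-- The polynomial `f(z) = z + a z^(m+1)`. -/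
def parabolicMap (a : ℂ) (m : ℕ) (z : ℂ) : ℂ := z + a * z ^ (m + 1)

/-- `v` is an attraction vector at the origin for a map `z + a z^(m+1) + ⋯`. -/
def IsAttractionVector (a : ℂ) (m : ℕ) (v : ℂ) : Prop := (m : ℂ) * a * v ^ m = -1

/-- The orbit of `z` under `f` tends to zero from the direction `v`:
it converges to `0` and `f^k(z) ∼ v / k^(1/m)` as `k → ∞`. -/
def TendsToZeroFrom (f : ℂ → ℂ) (m : ℕ) (v z : ℂ) : Prop :=
  Tendsto (fun k : ℕ => f^[k] z) atTop (𝓝 0) ∧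
    (fun k : ℕ => f^[k] z) ~[atTop] (fun k : ℕ => v / (((k : ℝ) ^ (1 / (m : ℝ)) : ℝ) : ℂ))

/-- The parabolic basin of attraction associated to the attraction vector `v`. -/
def parabolicBasin (f : ℂ → ℂ) (m : ℕ) (v : ℂ) : Set ℂ := {z | TendsToZeroFrom f m v z}

/-- `Ω` is the immediate basin for `v`: the connected component of the parabolic basin
that `f` maps into itself. -/
def IsImmediateBasin (f : ℂ → ℂ) (m : ℕ) (v : ℂ) (Ω : Set ℂ) : Prop :=
  (∃ z ∈ parabolicBasin f m v, Ω = connectedComponentIn (parabolicBasin f m v) z) ∧ MapsTo f Ω Ω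

/-- `P` is an attracting petal for the entire map `f` and the vector `v` at `0`: an open subset of a
neighbourhood `N` of `0` on which `f` is univalent, mapped into itself by `f`, and such that an
orbit is eventually absorbed by `P` if and only if it tends to zero from the direction `v`. -/
def IsAttractingPetal (f : ℂ → ℂ) (m : ℕ) (v : ℂ) (P : Set ℂ) : Prop :=
  (∃ N : Set ℂ, IsOpen N ∧ (0 : ℂ) ∈ N ∧ InjOn f N ∧ P ⊆ N) ∧ IsOpen P ∧ MapsTo f P P ∧
    ∀ z : ℂ, (∀ᶠ k : ℕ in atTop, f^[k] z ∈ P) ↔ TendsToZeroFrom f m v z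

/-- The grand orbit of `q` under `f`: the union over all `k, l ≥ 0` of `f^(-l)(f^k(q))`. -/
def grandOrbit (f : ℂ → ℂ) (q : ℂ) : Set ℂ := ⋃ (l : ℕ) (k : ℕ), f^[l] ⁻¹' {f^[k] q}

/-- The infinitesimal Kobayashi metric of `Ω` at the point `z` in the direction `ξ`: the infimum of
all `r > 0` such that `r g'(0) = ξ` for a holomorphic `g` from the unit disk to `Ω`
with `g(0) = z`. -/
noncomputable def kobayashiMetric (Ω : Set ℂ) (z ξ : ℂ) : ℝ≥0∞ :=
  sInf (ENNReal.ofReal '' {r : ℝ | 0 < r ∧ ∃ g : ℂ → ℂ,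
    DifferentiableOn ℂ g (Metric.ball 0 1) ∧ MapsTo g (Metric.ball 0 1) Ω ∧
      g 0 = z ∧ (r : ℂ) * deriv g 0 = ξ})

/-- `γ` is piecewise continuously differentiable on `[0, 1]`. -/
def PiecewiseC1 (γ : ℝ → ℂ) : Prop :=
  ∃ (n : ℕ) (t : ℕ → ℝ), Monotone t ∧ t 0 = 0 ∧ t n = 1 ∧
    ∀ i < n, ContDiffOn ℝ 1 γ (Icc (t i) (t (i + 1)))

/-- The Kobayashi length of `γ : [0, 1] → Ω`. -/
noncomputable def kobayashiLength (Ω : Set ℂ) (γ : ℝ → ℂ) : ℝ≥0∞ :=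
  ∫⁻ t in Icc (0 : ℝ) 1, kobayashiMetric Ω (γ t) (deriv γ t)

/-- The Kobayashi distance: the infimum of the Kobayashi lengths of the piecewise `C^1` curves
in `Ω` that connect the two points. -/
noncomputable def kobayashiDist (Ω : Set ℂ) (z w : ℂ) : ℝ≥0∞ :=
  sInf (kobayashiLength Ω '' {γ : ℝ → ℂ | PiecewiseC1 γ ∧ MapsTo γ (Icc 0 1) Ω ∧ γ 0 = z ∧ γ 1 = w})

/-! In the coordinate x = (z/v)^(-m) the map becomes `reciprocalStep`, which is x + 1 + O(1/x) near
infinity. It commutes with conjugation and is injective near infinity, so there it sends nonreal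
points to nonreal points. Points of the line through v have real x, and this line is invariant.
Hence a point with nonreal x in a forward invariant region near infinity is not in the grand orbit
of q (`notMem_grandOrbit`). Wedges supply such regions: for large |x| they omit only a sector of
half-angle about arctan(1/A) around the negative axis, and A is arbitrary
(`exists_isTranslationWedge`).

The basin avoids the negative x-axis (`pow_mem_slitPlane_of_mem_parabolicBasin`), so the principal
branch G = (z/v)^(m/2) maps Ω into the right half plane. Since holomorphic maps contract, log Re G
and arsinh(Im G / Re G) vary by at most twice the Kobayashi length of a curve
(`variation_le_kobayashiLength`). Take z₀ with Im G / Re G = sinh(2C+1) and Re G tiny. Every point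
at distance less than C then has slope positive and at most sinh(4C+1), with Re G still tiny. Its x
= G^(-2) is therefore nonreal and in the wedge with A = sinh(4C+1), outside the grand orbit. -/

/-- The map `x ↦ x (1 - 1/(m x))^(-m)`, to which `ζ ↦ ζ - ζ^(m+1)/m` is semiconjugate under
`x = ζ^(-m)`. -/
noncomputable def reciprocalStep (m : ℕ) (x : ℂ) : ℂ := x * ((1 - x⁻¹ / m) ^ m)⁻¹

/-- The principal branch of `x ↦ x^(-1/m)`. -/
noncomputable def rootBranch (m : ℕ) (x : ℂ) : ℂ := Complex.exp (-(Complex.log x) / m)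

/-- The union of the half planes `Re x ± A Im x > L`. -/
def wedge (A L : ℝ) : Set ℂ := {x | L < x.re + A * |x.im|}

/-! ### Geometry of wedges. -/

section Wedge

variable {A L : ℝ} {x : ℂ}

lemma wedge_subset_slitPlane (hL : 0 ≤ L) : wedge A L ⊆ Complex.slitPlane := by
  intro x hx
  rw [Complex.mem_slitPlane_iff]
  by_contra! h
  simp only [wedge, mem_ofPred_eq, h.2, abs_zero, mul_zero, add_zero] at hx
  linarith [h.1]

lemma norm_of_mem_wedge (hA : 0 ≤ A) (hx : x ∈ wedge A L) : L < (1 + A) * ‖x‖ := by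
  have h1 := Complex.re_le_norm x
  have h2 := Complex.abs_im_le_norm x
  have h3 : L < x.re + A * |x.im| := hx
  nlinarith [mul_le_mul_of_nonneg_left h2 hA]

lemma isPreconnected_wedge (hA : 0 ≤ A) : IsPreconnected (wedge A L) := by
  have h : wedge A L = {x : ℂ | L < (Complex.reLm + A • Complex.imLm) x} ∪
      {x : ℂ | L < (Complex.reLm - A • Complex.imLm) x} := by
    ext x
    simp only [wedge, mem_ofPred_eq, mem_union, LinearMap.add_apply, LinearMap.sub_apply,
      LinearMap.smul_apply, Complex.reLm_coe, Complex.imLm_coe, smul_eq_mul]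
    rcases abs_cases x.im with ⟨h, h'⟩ | ⟨h, h'⟩ <;> rw [h]
    · constructor
      · exact fun h => Or.inl h
      · rintro (h | h) <;> nlinarith
    · constructor
      · exact fun h => Or.inr (by linarith)
      · rintro (h | h) <;> nlinarith
  rw [h]
  refine IsPreconnected.union ((L + 1 : ℝ) : ℂ) ?_ ?_
    (convex_halfSpace_gt (LinearMap.isLinear _) L).isPreconnected
    (convex_halfSpace_gt (LinearMap.isLinear _) L).isPreconnected
  · simp
  · simp

end Wedge

/-! ### The branch of x^(-1/m) on the slit plane. -/

section RootBranch

variable {m : ℕ}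

lemma rootBranch_pow (hm : m ≠ 0) {x : ℂ} (hx : x ≠ 0) : rootBranch m x ^ m = x⁻¹ := by
  have : (m : ℂ) ≠ 0 := Nat.cast_ne_zero.2 hm
  rw [rootBranch, ← Complex.exp_nat_mul, mul_div_cancel₀ _ this, Complex.exp_neg,
    Complex.exp_log hx]

lemma continuousOn_rootBranch : ContinuousOn (rootBranch m) Complex.slitPlane := by
  unfold rootBranch
  exact Complex.continuous_exp.comp_continuousOn
    ((ContinuousOn.clog continuousOn_id fun x hx => hx).neg.div_const _)

lemma rootBranch_one : rootBranch m 1 = 1 := by simp [rootBranch]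

lemma rootBranch_ofReal_mul (r : ℝ) (hr : 0 < r) {x : ℂ} (hx : x ≠ 0) :
    rootBranch m (r * x) = rootBranch m x / ((r ^ (1 / (m : ℝ)) : ℝ) : ℂ) := by
  rw [rootBranch, rootBranch, Complex.log_ofReal_mul hr hx, Real.rpow_def_of_pos hr,
    Complex.ofReal_exp, ← Complex.exp_sub]
  congr 1
  push_cast
  ring

/-- Near `1`, `rootBranch m` inverts `c ↦ c^(-m)`. -/
lemma eventually_rootBranch_inv_pow (hm : m ≠ 0) :
    ∀ᶠ c : ℂ in 𝓝 1, rootBranch m ((c ^ m)⁻¹) = c := by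
  have hm' : (m : ℂ) ≠ 0 := Nat.cast_ne_zero.2 hm
  have hlog : ContinuousAt (fun c : ℂ => (-(m : ℂ) * Complex.log c).im) 1 :=
    (Complex.continuous_im.continuousAt).comp
      (continuousAt_const.mul (continuousAt_clog Complex.one_mem_slitPlane))
  have h0 : (-(m : ℂ) * Complex.log 1).im = 0 := by simp
  have h1 : ∀ᶠ c : ℂ in 𝓝 1, (-(m : ℂ) * Complex.log c).im ∈ Ioo (-Real.pi) Real.pi :=
    hlog.eventually_mem (Ioo_mem_nhds (by rw [h0]; linarith [Real.pi_pos])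
      (by rw [h0]; exact Real.pi_pos))
  filter_upwards [h1, isOpen_ne.mem_nhds (one_ne_zero (α := ℂ))] with c hc hc0
  have h2 : (c ^ m)⁻¹ = Complex.exp (-(m : ℂ) * Complex.log c) := by
    rw [neg_mul, Complex.exp_neg, Complex.exp_nat_mul, Complex.exp_log hc0]
  rw [rootBranch, h2, Complex.log_exp hc.1 hc.2.le, neg_mul, neg_neg, mul_div_cancel_left₀ _ hm',
    Complex.exp_log hc0]

end RootBranch

/-! ### Dynamics of one step near infinity. -/

section Step

variable {m : ℕ}

/-- The polynomial has real coefficients and derivative 1 at 0, so it is injective near 0. A real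
value is shared by y and its conjugate, which must then coincide. -/
lemma eventually_injective_conj (m : ℕ) :
    ∀ᶠ y : ℂ in 𝓝 0, (y * (1 - y / m) ^ m).im = 0 → y.im = 0 := by
  set p : ℂ → ℂ := fun y => y * (1 - y / m) ^ m with hp
  have hs : HasStrictDerivAt p 1 0 := by
    have h := (hasStrictDerivAt_id (0 : ℂ)).fun_mul
      ((((hasStrictDerivAt_id (0 : ℂ)).div_const (m : ℂ)).const_sub 1).fun_pow m)
    simpa using h
  have hinv := (hs.hasStrictFDerivAt_equiv one_ne_zero).eventually_left_inverse
  have hconj : Tendsto (starRingEnd ℂ) (𝓝 0) (𝓝 0) := by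
    simpa using (Complex.continuous_conj.tendsto (0 : ℂ))
  filter_upwards [hinv, hconj.eventually hinv] with y h1 h2 h3
  have h4 : p (starRingEnd ℂ y) = p y := by
    have h5 : starRingEnd ℂ (p y) = p y := Complex.conj_eq_iff_im.2 h3
    rw [← h5]
    simp [hp]
  rw [h4, h1] at h2
  exact Complex.conj_eq_iff_im.1 h2.symm

/-- The estimates on `reciprocalStep` near `∞`. -/
lemma exists_reciprocalStep_bounds (hm : m ≠ 0) {ε : ℝ} (hε : 0 < ε) :
    ∃ R > 0, ∀ x : ℂ, R ≤ ‖x‖ → 1 - x⁻¹ / m ≠ 0 ∧ m * |(1 - x⁻¹ / m).arg| < Real.pi ∧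
      ‖reciprocalStep m x - x - 1‖ ≤ ε ∧ ((reciprocalStep m x).im = 0 → x.im = 0) := by
  have hm' : (m : ℂ) ≠ 0 := Nat.cast_ne_zero.2 hm
  have hu : Tendsto (fun y : ℂ => 1 - y / m) (𝓝 0) (𝓝 1) := by
    have : Continuous (fun y : ℂ => 1 - y / m) := by fun_prop
    simpa using this.tendsto 0
  have e1 : ∀ᶠ y : ℂ in 𝓝 0, 1 - y / m ≠ 0 := hu.eventually_ne one_ne_zero
  have e2 : ∀ᶠ y : ℂ in 𝓝 0, m * |(1 - y / m).arg| < Real.pi := by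
    have h1 : Tendsto (fun y : ℂ => m * |(1 - y / m).arg|) (𝓝 0) (𝓝 (m * |(1 : ℂ).arg|)) :=
      (((Complex.continuousAt_arg Complex.one_mem_slitPlane).tendsto.comp hu).abs).const_mul _
    refine h1.eventually_lt_const ?_
    simpa using Real.pi_pos
  have e3 : ∀ᶠ y : ℂ in 𝓝 0, ‖((1 - y / m) ^ m)⁻¹ - 1 - y‖ ≤ ε * ‖y‖ := by
    have h : HasDerivAt (fun y : ℂ => ((1 - y / m) ^ m)⁻¹) 1 0 := by
      have h := ((((hasDerivAt_id (0 : ℂ)).div_const (m : ℂ)).const_sub 1).fun_pow m).fun_inv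
        (by simp)
      simpa [hm'] using h
    have := h.isLittleO.def hε
    simpa using this
  obtain ⟨δ, hδ, h⟩ := Metric.eventually_nhds_iff.1
    (e1.and (e2.and (e3.and (eventually_injective_conj m))))
  refine ⟨2 / δ, by positivity, fun x hx => ?_⟩
  have hx0 : 0 < ‖x‖ := lt_of_lt_of_le (by positivity) hx
  have hxne : x ≠ 0 := norm_pos_iff.1 hx0
  have hδx : dist x⁻¹ 0 < δ := by
    rw [dist_zero_right, norm_inv, inv_lt_comm₀ hx0 hδ]
    refine lt_of_lt_of_le ?_ hx
    rw [inv_eq_one_div]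
    gcongr
    norm_num
  obtain ⟨h1, h2, h3, h4⟩ := h hδx
  refine ⟨h1, h2, ?_, fun hi => ?_⟩
  · have : reciprocalStep m x - x - 1 = x * (((1 - x⁻¹ / m) ^ m)⁻¹ - 1 - x⁻¹) := by
      rw [reciprocalStep, mul_sub, mul_sub, mul_inv_cancel₀ hxne, mul_one]
    rw [this, norm_mul]
    calc ‖x‖ * _ ≤ ‖x‖ * (ε * ‖x⁻¹‖) := by gcongr
      _ = ε := by rw [norm_inv]; field_simp
  -- In the variable y = 1/x the step is the polynomial of `eventually_injective_conj`.
  · have h5 : x⁻¹ * (1 - x⁻¹ / m) ^ m = (reciprocalStep m x)⁻¹ := by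
      rw [reciprocalStep, mul_inv, inv_inv]
    have h6 := h4 (by rw [h5, Complex.inv_im, hi]; simp)
    rw [Complex.inv_im, div_eq_zero_iff] at h6
    rcases h6 with h6 | h6
    · linarith
    · exact absurd (Complex.normSq_eq_zero.1 h6) hxne

/-- `reciprocalStep m` is semiconjugate, by the principal branch of the root, to
`ζ ↦ ζ - ζ^(m+1)/m`. -/
lemma rootBranch_reciprocalStep (hm : m ≠ 0) {x : ℂ} (hx : x ∈ Complex.slitPlane)
    (hu : 1 - x⁻¹ / m ≠ 0) (harg : m * |(1 - x⁻¹ / m).arg| < Real.pi) :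
    rootBranch m (reciprocalStep m x) = rootBranch m x * (1 - x⁻¹ / m) := by
  have hm' : (m : ℂ) ≠ 0 := Nat.cast_ne_zero.2 hm
  have hmr : (0 : ℝ) < m := Nat.cast_pos.2 (Nat.pos_of_ne_zero hm)
  have hx0 : x ≠ 0 := Complex.slitPlane_ne_zero hx
  set u := 1 - x⁻¹ / m with hu_def
  have hT : reciprocalStep m x = Complex.exp (Complex.log x - m * Complex.log u) := by
    rw [reciprocalStep, ← hu_def, Complex.exp_sub, Complex.exp_nat_mul, Complex.exp_log hx0,
      Complex.exp_log hu, div_eq_mul_inv]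
  have him : (Complex.log x - m * Complex.log u).im = x.arg - m * u.arg := by
    simp [Complex.log_im]
  have huim : u.im = x.im / (m * Complex.normSq x) := by
    have h1 : (x⁻¹ / (m : ℂ)).im = x⁻¹.im / m := by
      have := Complex.div_ofReal_im x⁻¹ (m : ℝ)
      rwa [Complex.ofReal_natCast] at this
    rw [hu_def, Complex.sub_im, Complex.one_im, h1, Complex.inv_im]
    field_simp
    ring
  have hN : 0 < (m : ℝ) * Complex.normSq x := mul_pos hmr (Complex.normSq_pos.2 hx0)
  have hpi : x.arg < Real.pi :=
    lt_of_le_of_ne (Complex.arg_le_pi x) (Complex.slitPlane_arg_ne_pi hx)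
  -- Since Im u and Im x have the same sign, arg x and m arg u lie on the same side of 0. Both are
  -- below π in modulus, so their difference causes no jump of the logarithm.
  have hb : -Real.pi < x.arg - m * u.arg ∧ x.arg - m * u.arg ≤ Real.pi := by
    rcases le_or_gt 0 x.im with h | h
    · have h1 : 0 ≤ u.arg := Complex.arg_nonneg_iff.2 (by rw [huim]; positivity)
      have h2 : 0 ≤ x.arg := Complex.arg_nonneg_iff.2 h
      rw [abs_of_nonneg h1] at harg
      have := mul_nonneg hmr.le h1
      constructor <;> linarith
    · have h1 : u.arg < 0 := Complex.arg_neg_iff.2 (by rw [huim]; exact div_neg_of_neg_of_pos h hN)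
      have h2 : x.arg < 0 := Complex.arg_neg_iff.2 h
      rw [abs_of_neg h1] at harg
      have := mul_neg_of_pos_of_neg hmr h1
      have := Complex.neg_pi_lt_arg x
      constructor <;> linarith
  rw [rootBranch, hT, Complex.log_exp (by rw [him]; exact hb.1) (by rw [him]; exact hb.2),
    rootBranch, ← Complex.exp_log hu, ← Complex.exp_add, Complex.log_exp
    (by rw [Complex.log_im]; exact Complex.neg_pi_lt_arg _)
    (by rw [Complex.log_im]; exact Complex.arg_le_pi _)]
  congr 1
  field_simp
  ring

/-- A wedge on which `reciprocalStep m` behaves like `x ↦ x + 1`. -/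
structure IsTranslationWedge (m : ℕ) (A L : ℝ) : Prop where
  nonneg : 0 ≤ A
  pos : 0 < L
  mapsTo : MapsTo (reciprocalStep m) (wedge A L) (wedge A L)
  re_add_le : ∀ x ∈ wedge A L, x.re + 1 / 2 ≤ (reciprocalStep m x).re
  rootBranch_step : ∀ x ∈ wedge A L,
    rootBranch m (reciprocalStep m x) = rootBranch m x * (1 - x⁻¹ / m)
  im_ne_zero : ∀ x ∈ wedge A L, x.im ≠ 0 → (reciprocalStep m x).im ≠ 0

/-- Wedges of every opening contain a translation wedge. -/
lemma exists_isTranslationWedge (hm : m ≠ 0) {A : ℝ} (hA : 0 ≤ A) :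
    ∃ L, IsTranslationWedge m A L := by
  suffices ∃ L > 0, ∀ x ∈ wedge A L, reciprocalStep m x ∈ wedge A L ∧
      x.re + 1 / 2 ≤ (reciprocalStep m x).re ∧
      rootBranch m (reciprocalStep m x) = rootBranch m x * (1 - x⁻¹ / m) ∧
      (x.im ≠ 0 → (reciprocalStep m x).im ≠ 0) by
    obtain ⟨L, hL, h⟩ := this
    exact ⟨L, hA, hL, fun x hx => (h x hx).1, fun x hx => (h x hx).2.1,
      fun x hx => (h x hx).2.2.1, fun x hx => (h x hx).2.2.2⟩
  -- An error ε in the unit translation costs at most (1 + A)ε = 1/2 in Re x + A|Im x|, leaving a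
  -- gain of 1/2.
  obtain ⟨R, hR, h⟩ := exists_reciprocalStep_bounds hm (ε := 1 / (2 * (1 + A))) (by positivity)
  refine ⟨(1 + A) * R, by positivity, fun x hx => ?_⟩
  have hxR : R ≤ ‖x‖ := by
    have := norm_of_mem_wedge hA hx
    exact (lt_of_mul_lt_mul_left this (by positivity)).le
  obtain ⟨h1, h2, h3, h4⟩ := h x hxR
  have hre := (abs_le.1 ((Complex.abs_re_le_norm _).trans h3)).1
  have him := (Complex.abs_im_le_norm _).trans h3
  simp only [Complex.sub_re, Complex.sub_im, Complex.one_re, Complex.one_im, sub_zero] at hre him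
  have hε : 1 / (2 * (1 + A)) * (1 + A) = 1 / 2 := by field_simp
  have hε' : 1 / (2 * (1 + A)) ≤ 1 / 2 := by
    apply one_div_le_one_div_of_le <;> linarith
  have habs : |x.im| - 1 / (2 * (1 + A)) ≤ |(reciprocalStep m x).im| := by
    have := abs_sub_abs_le_abs_sub x.im (reciprocalStep m x).im
    rw [abs_sub_comm] at this
    linarith
  have hx' : (1 + A) * R < x.re + A * |x.im| := hx
  refine ⟨?_, by linarith, rootBranch_reciprocalStep hm
    (wedge_subset_slitPlane (by positivity) hx) h1 h2, mt h4⟩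
  change (1 + A) * R < (reciprocalStep m x).re + A * |(reciprocalStep m x).im|
  have := mul_le_mul_of_nonneg_left habs hA
  linarith

end Step

/-! ### Lower bounds for the Kobayashi length from maps to the half plane. -/

section Kobayashi

/-- The Schwarz–Pick inequality for maps of the disk into the right half plane. -/
lemma norm_deriv_le_two_re {g : ℂ → ℂ} (hg : DifferentiableOn ℂ g (Metric.ball 0 1))
    (hre : ∀ z ∈ Metric.ball (0 : ℂ) 1, 0 < (g z).re) : ‖deriv g 0‖ ≤ 2 * (g 0).re := by
  have h0 : (0 : ℂ) ∈ Metric.ball (0 : ℂ) 1 := Metric.mem_ball_self one_pos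
  set w := g 0 with hw
  have hwre : 0 < w.re := hre 0 h0
  have hden : ∀ z ∈ Metric.ball (0 : ℂ) 1, g z + starRingEnd ℂ w ≠ 0 := fun z hz h => by
    have := congrArg Complex.re h
    simp only [Complex.add_re, Complex.conj_re, Complex.zero_re] at this
    linarith [hre z hz]
  -- The Cayley transform centred at g(0) reduces the claim to the Schwarz lemma.
  set φ : ℂ → ℂ := fun z => (g z - w) / (g z + starRingEnd ℂ w) with hφ
  have hd : DifferentiableOn ℂ φ (Metric.ball 0 1) :=
    (hg.sub_const _).div (hg.add_const _) hden
  have hφ0 : φ 0 = 0 := by simp [hφ, ← hw]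
  have hmaps : MapsTo φ (Metric.ball 0 1) (Metric.closedBall (φ 0) 1) := by
    intro z hz
    rw [hφ0, mem_closedBall_zero_iff, hφ]
    simp only [norm_div]
    refine div_le_one_of_le₀ ?_ (norm_nonneg _)
    rw [Complex.norm_def, Complex.norm_def]
    refine Real.sqrt_le_sqrt ?_
    simp only [Complex.normSq_apply, Complex.sub_re, Complex.sub_im, Complex.add_re,
      Complex.add_im, Complex.conj_re, Complex.conj_im]
    nlinarith [mul_pos hwre (hre z hz)]
  have h1 := Complex.norm_deriv_le_one_of_mapsTo_ball hd hmaps one_pos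
  have hg' := (hg.differentiableAt (Metric.isOpen_ball.mem_nhds h0)).hasDerivAt
  have hsum : w + starRingEnd ℂ w = ((2 * w.re : ℝ) : ℂ) := by
    rw [Complex.add_conj]
  have hne : ((2 * w.re : ℝ) : ℂ) ≠ 0 := by exact_mod_cast (by positivity : 2 * w.re ≠ 0)
  have h2 : deriv φ 0 = deriv g 0 / ((2 * w.re : ℝ) : ℂ) := by
    have h3 := ((hg'.sub_const w).fun_div (hg'.add_const (starRingEnd ℂ w)) (hden 0 h0)).deriv
    rw [hφ, h3, ← hw, hsum]
    field_simp
    ring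
  rw [h2, norm_div, Complex.norm_real, Real.norm_of_nonneg (by positivity),
    div_le_one (by positivity)] at h1
  exact h1

variable {Ω : Set ℂ} {G : ℂ → ℂ}

lemma le_kobayashiMetric (hG : ∀ z ∈ Ω, DifferentiableAt ℂ G z) (hre : ∀ z ∈ Ω, 0 < (G z).re)
    {z : ℂ} (hz : z ∈ Ω) (ξ : ℂ) :
    ENNReal.ofReal (‖deriv G z * ξ‖ / (2 * (G z).re)) ≤ kobayashiMetric Ω z ξ := by
  refine le_sInf ?_
  rintro _ ⟨r, ⟨hr, g, hg, hmaps, rfl, rfl⟩, rfl⟩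
  refine ENNReal.ofReal_le_ofReal ?_
  have h0 : (0 : ℂ) ∈ Metric.ball (0 : ℂ) 1 := Metric.mem_ball_self one_pos
  have hd : DifferentiableOn ℂ (G ∘ g) (Metric.ball 0 1) := fun u hu =>
    ((hG _ (hmaps hu)).comp_differentiableWithinAt u (hg u hu))
  have h1 := norm_deriv_le_two_re hd fun u hu => hre _ (hmaps hu)
  rw [deriv_comp 0 (hG _ hz) (hg.differentiableAt (Metric.isOpen_ball.mem_nhds h0))] at h1
  have := hre _ hz
  rw [div_le_iff₀ (by positivity)]
  calc ‖deriv G (g 0) * (r * deriv g 0)‖ = r * ‖deriv G (g 0) * deriv g 0‖ := by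
        rw [mul_left_comm, norm_mul, Complex.norm_real, Real.norm_of_nonneg hr.le]
    _ ≤ r * (2 * (G (g 0)).re) := by gcongr; exact h1

/-- A function on a curve whose speed is bounded by twice the Kobayashi speed varies
by at most twice the Kobayashi length. -/
lemma enorm_sub_le_kobayashiLength {γ : ℝ → ℂ} {φ : ℝ → ℝ} {n : ℕ} {t : ℕ → ℝ} (ht : Monotone t)
    (h0 : t 0 = 0) (h1 : t n = 1) (hφ : ∀ i < n, ContDiffOn ℝ 1 φ (Icc (t i) (t (i + 1))))
    (hle : ∀ i < n, ∀ s ∈ Ioo (t i) (t (i + 1)),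
      ‖deriv φ s‖ₑ ≤ 2 * kobayashiMetric Ω (γ s) (deriv γ s)) :
    ‖φ 1 - φ 0‖ₑ ≤ 2 * kobayashiLength Ω γ := by
  have key : ∀ k ≤ n, ‖φ (t k) - φ 0‖ₑ ≤
      ∫⁻ s in Ioc 0 (t k), 2 * kobayashiMetric Ω (γ s) (deriv γ s) := by
    intro k
    induction k with
    | zero => intro _; simp [h0]
    | succ k ih =>
      intro hk
      have hmono : t k ≤ t (k + 1) := ht (Nat.le_succ k)
      have h0k : 0 ≤ t k := h0 ▸ ht (Nat.zero_le k)
      have hstep : ‖φ (t (k + 1)) - φ (t k)‖ₑ ≤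
          ∫⁻ s in Ioc (t k) (t (k + 1)), 2 * kobayashiMetric Ω (γ s) (deriv γ s) := by
        refine (enorm_sub_le_lintegral_deriv_of_contDiffOn_Icc (hφ k hk) hmono).trans ?_
        -- Breakpoints, where γ need not be differentiable, form a null set.
        rw [setLIntegral_congr Ioo_ae_eq_Icc.symm, setLIntegral_congr Ioo_ae_eq_Ioc.symm]
        exact setLIntegral_mono' measurableSet_Ioo (hle k hk)
      rw [← Ioc_union_Ioc_eq_Ioc h0k hmono,
        lintegral_union measurableSet_Ioc (Ioc_disjoint_Ioc_of_le le_rfl)]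
      calc ‖φ (t (k + 1)) - φ 0‖ₑ = ‖(φ (t k) - φ 0) + (φ (t (k + 1)) - φ (t k))‖ₑ := by
            congr 1; ring
        _ ≤ _ := (enorm_add_le _ _).trans (add_le_add (ih (by omega)) hstep)
  have h2 := key n le_rfl
  -- The finite constant 2 leaves the integral without any measurability of the Kobayashi metric.
  rwa [h1, lintegral_const_mul' _ _ (by simp), setLIntegral_congr Ioc_ae_eq_Icc] at h2

lemma two_mul_kobayashiMetric_ge (hG : ∀ z ∈ Ω, DifferentiableAt ℂ G z)
    (hre : ∀ z ∈ Ω, 0 < (G z).re) {z : ℂ} (hz : z ∈ Ω) (ξ : ℂ) {d : ℝ}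
    (hd : |d| ≤ ‖deriv G z * ξ‖ / (G z).re) : ‖d‖ₑ ≤ 2 * kobayashiMetric Ω z ξ := by
  have h := le_kobayashiMetric hG hre hz ξ
  calc ‖d‖ₑ = ENNReal.ofReal |d| := by rw [← Real.norm_eq_abs, ofReal_norm]
    _ ≤ ENNReal.ofReal (2 * (‖deriv G z * ξ‖ / (2 * (G z).re))) := by
      refine ENNReal.ofReal_le_ofReal (hd.trans_eq ?_)
      have := (hre z hz).ne'
      field_simp
    _ = 2 * ENNReal.ofReal (‖deriv G z * ξ‖ / (2 * (G z).re)) := by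
      rw [ENNReal.ofReal_mul (by norm_num)]; norm_num
    _ ≤ _ := by gcongr

/-- Along a curve, `log Re G` and `arsinh (Im G / Re G)` vary by at most twice the
Kobayashi length, for every holomorphic `G` with values in the right half plane. -/
lemma variation_le_kobayashiLength (hG : ∀ z ∈ Ω, DifferentiableAt ℂ G z)
    (hG' : ContDiffOn ℝ 1 G Ω)
    (hre : ∀ z ∈ Ω, 0 < (G z).re) {γ : ℝ → ℂ} (hγ : PiecewiseC1 γ)
    (hmaps : MapsTo γ (Icc 0 1) Ω) :
    ‖Real.log (G (γ 1)).re - Real.log (G (γ 0)).re‖ₑ ≤ 2 * kobayashiLength Ω γ ∧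
    ‖Real.arsinh ((G (γ 1)).im / (G (γ 1)).re) - Real.arsinh ((G (γ 0)).im / (G (γ 0)).re)‖ₑ ≤
      2 * kobayashiLength Ω γ := by
  obtain ⟨n, t, ht, h0, h1, hC⟩ := hγ
  have hsub : ∀ i < n, Icc (t i) (t (i + 1)) ⊆ Icc 0 1 := fun i hi =>
    Icc_subset_Icc (h0 ▸ ht (Nat.zero_le i)) (h1 ▸ ht hi)
  have hGγ : ∀ i < n, ContDiffOn ℝ 1 (fun s => G (γ s)) (Icc (t i) (t (i + 1))) := fun i hi =>
    hG'.comp (hC i hi) (hmaps.mono_left (hsub i hi))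
  have hX : ∀ i < n, ContDiffOn ℝ 1 (fun s => (G (γ s)).re) (Icc (t i) (t (i + 1))) :=
    fun i hi => Complex.reCLM.contDiff.comp_contDiffOn (hGγ i hi)
  have hY : ∀ i < n, ContDiffOn ℝ 1 (fun s => (G (γ s)).im) (Icc (t i) (t (i + 1))) :=
    fun i hi => Complex.imCLM.contDiff.comp_contDiffOn (hGγ i hi)
  have hpos : ∀ i < n, ∀ s ∈ Icc (t i) (t (i + 1)), (G (γ s)).re ≠ 0 := fun i hi s hs =>
    (hre _ (hmaps (hsub i hi hs))).ne'
  have hder : ∀ i < n, ∀ s ∈ Ioo (t i) (t (i + 1)),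
      HasDerivAt (fun s => G (γ s)) (deriv G (γ s) * deriv γ s) s := fun i hi s hs => by
    have hd : DifferentiableAt ℝ γ s :=
      ((hC i hi).differentiableOn one_ne_zero).differentiableAt (Icc_mem_nhds hs.1 hs.2)
    have := HasDerivAt.scomp_of_eq s (hG _ (hmaps (hsub i hi ⟨hs.1.le, hs.2.le⟩))).hasDerivAt
      hd.hasDerivAt rfl
    rwa [smul_eq_mul, mul_comm] at this
  have hre' : ∀ i < n, ∀ s ∈ Ioo (t i) (t (i + 1)),
      HasDerivAt (fun s => (G (γ s)).re) (deriv G (γ s) * deriv γ s).re s := fun i hi s hs =>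
    Complex.reCLM.hasFDerivAt.comp_hasDerivAt s (hder i hi s hs)
  have him' : ∀ i < n, ∀ s ∈ Ioo (t i) (t (i + 1)),
      HasDerivAt (fun s => (G (γ s)).im) (deriv G (γ s) * deriv γ s).im s := fun i hi s hs =>
    Complex.imCLM.hasFDerivAt.comp_hasDerivAt s (hder i hi s hs)
  constructor
  · refine enorm_sub_le_kobayashiLength (φ := fun s => Real.log (G (γ s)).re) ht h0 h1
      (fun i hi => (hX i hi).log (hpos i hi)) fun i hi s hs => ?_
    have hs' : s ∈ Icc (t i) (t (i + 1)) := ⟨hs.1.le, hs.2.le⟩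
    have hz := hmaps (hsub i hi hs')
    have hp := hre _ hz
    have hdr := (HasDerivAt.log (hre' i hi s hs) hp.ne')
    rw [hdr.deriv]
    refine two_mul_kobayashiMetric_ge hG hre hz _ ?_
    rw [abs_div, abs_of_pos hp]
    gcongr
    exact Complex.abs_re_le_norm _
  · refine enorm_sub_le_kobayashiLength
      (φ := fun s => Real.arsinh ((G (γ s)).im / (G (γ s)).re)) ht h0 h1
      (fun i hi => ((hY i hi).div (hX i hi) (hpos i hi)).arsinh) fun i hi s hs => ?_
    have hs' : s ∈ Icc (t i) (t (i + 1)) := ⟨hs.1.le, hs.2.le⟩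
    have hz := hmaps (hsub i hi hs')
    have hp := hre _ hz
    have hdr := ((him' i hi s hs).fun_div (hre' i hi s hs) hp.ne').arsinh
    rw [hdr.deriv]
    refine two_mul_kobayashiMetric_ge hG hre hz _ ?_
    set D := deriv G (γ s) * deriv γ s
    set X := (G (γ s)).re
    set Y := (G (γ s)).im
    have hsq : 0 < √(1 + (Y / X) ^ 2) := Real.sqrt_pos.2 (by positivity)
    rw [smul_eq_mul, abs_mul, abs_inv, abs_of_pos hsq, inv_mul_le_iff₀ hsq]
    refine abs_le_of_sq_le_sq ?_ (by positivity)
    rw [mul_pow, Real.sq_sqrt (by positivity), div_pow ‖D‖, ← Complex.normSq_eq_norm_sq,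
      Complex.normSq_apply]
    have hX0 : X ≠ 0 := hp.ne'
    -- Lagrange's identity for D and G: the component of D along G is what the derivative of the
    -- slope does not see. In the metric |dG|/Re G the function arsinh(Im G / Re G) is the signed
    -- distance to the real axis, hence 1-Lipschitz.
    have : (1 + (Y / X) ^ 2) * ((D.re * D.re + D.im * D.im) / X ^ 2) -
        ((D.im * X - Y * D.re) / X ^ 2) ^ 2 = ((D.re * X + D.im * Y) / X ^ 2) ^ 2 := by
      field_simp
      ring
    nlinarith [sq_nonneg ((D.re * X + D.im * Y) / X ^ 2)]

end Kobayashi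

/-! ### Iteration in a translation wedge. -/

namespace IsTranslationWedge

variable {m : ℕ} {A L : ℝ}

lemma iterate_mem (h : IsTranslationWedge m A L) {x : ℂ} (hx : x ∈ wedge A L) (k : ℕ) :
    (reciprocalStep m)^[k] x ∈ wedge A L :=
  h.mapsTo.iterate k hx

lemma iterate_re (h : IsTranslationWedge m A L) {x : ℂ} (hx : x ∈ wedge A L) (k : ℕ) :
    x.re + k / 2 ≤ ((reciprocalStep m)^[k] x).re := by
  induction k with
  | zero => simp
  | succ k ih =>
    rw [Function.iterate_succ_apply']
    have := h.re_add_le _ (h.iterate_mem hx k)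
    push_cast
    linarith

lemma iterate_im_ne_zero (h : IsTranslationWedge m A L) {x : ℂ} (hx : x ∈ wedge A L)
    (him : x.im ≠ 0) (k : ℕ) : ((reciprocalStep m)^[k] x).im ≠ 0 := by
  induction k with
  | zero => exact him
  | succ k ih =>
    rw [Function.iterate_succ_apply']
    exact h.im_ne_zero _ (h.iterate_mem hx k) ih

lemma tendsto_iterate_div (hm : m ≠ 0) (h : IsTranslationWedge m A L) {x : ℂ}
    (hx : x ∈ wedge A L) :
    Tendsto (fun k : ℕ => (reciprocalStep m)^[k] x / k) atTop (𝓝 1) := by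
  set u : ℕ → ℂ := fun k => (reciprocalStep m)^[k] x with hu
  have hre : Tendsto (fun k => (u k).re) atTop atTop := by
    refine tendsto_atTop_mono (h.iterate_re hx) (tendsto_atTop_add_const_left _ _ ?_)
    exact tendsto_natCast_atTop_atTop.atTop_div_const two_pos
  have hnorm : Tendsto (fun k => ‖u k‖) atTop atTop :=
    tendsto_atTop_mono (fun k => Complex.re_le_norm _) hre
  have hdiff : Tendsto (fun k => u (k + 1) - u k) atTop (𝓝 1) := by
    rw [Metric.tendsto_atTop']
    intro ε hε
    obtain ⟨R, -, hb⟩ := exists_reciprocalStep_bounds hm (half_pos hε)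
    obtain ⟨N, hN⟩ := (hnorm.eventually_ge_atTop R).exists_forall_of_atTop
    refine ⟨N, fun k hk => ?_⟩
    have := (hb _ (hN k hk.le)).2.2.1
    rw [dist_eq_norm, hu]
    simp only [Function.iterate_succ_apply']
    exact this.trans_lt (half_lt_self hε)
  -- The increments tend to 1, and their Cesàro means telescope to (u k - x)/k.
  have hces := hdiff.cesaro_smul
  simp only [Finset.sum_range_sub] at hces
  have hzero : Tendsto (fun k : ℕ => x / (k : ℂ)) atTop (𝓝 0) := by
    have h1 : Tendsto (fun k : ℕ => ((k : ℂ))⁻¹) atTop (𝓝 0) := tendsto_inv_atTop_nhds_zero_nat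
    simpa [div_eq_mul_inv] using h1.const_mul x
  have := hces.add hzero
  rw [add_zero] at this
  refine this.congr fun k => ?_
  have h0 : u 0 = x := rfl
  rw [h0, Complex.real_smul]
  push_cast
  rw [div_eq_inv_mul, div_eq_inv_mul]
  ring

end IsTranslationWedge

/-! ### The parabolic basin in the coordinate x. -/

section Basin

variable {m : ℕ} {a v : ℂ}

lemma IsAttractionVector.ne_zero (hm : m ≠ 0) (hv : IsAttractionVector a m v) : v ≠ 0 := by
  rintro rfl
  simp [IsAttractionVector, hm] at hv

lemma parabolicMap_mul (hm : m ≠ 0) (hv : IsAttractionVector a m v) (ζ : ℂ) :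
    parabolicMap a m (v * ζ) = v * (ζ * (1 - ζ ^ m / m)) := by
  have hm' : (m : ℂ) ≠ 0 := Nat.cast_ne_zero.2 hm
  have h : a * v ^ m = -1 / m := by
    rw [eq_div_iff hm', ← hv]; ring
  calc parabolicMap a m (v * ζ) = v * (ζ + a * v ^ m * ζ * ζ ^ m) := by
        rw [parabolicMap]; ring
    _ = _ := by rw [h]; ring

/-- The coordinate `(z/v)^(-m)` semiconjugates the map to `reciprocalStep m`. -/
lemma parabolicMap_semiconj (hm : m ≠ 0) (hv : IsAttractionVector a m v) :
    Function.Semiconj (fun z => ((z / v) ^ m)⁻¹) (parabolicMap a m) (reciprocalStep m) := by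
  intro z
  have hv0 := hv.ne_zero hm
  have h : parabolicMap a m z = v * (z / v * (1 - (z / v) ^ m / m)) := by
    rw [← parabolicMap_mul hm hv, mul_div_cancel₀ _ hv0]
  simp only [h, mul_div_cancel_left₀ _ hv0, mul_pow, mul_inv, reciprocalStep, inv_inv]

lemma parabolicMap_iterate_rootBranch (hm : m ≠ 0) (hv : IsAttractionVector a m v) {A L : ℝ}
    (h : IsTranslationWedge m A L) {x : ℂ} (hx : x ∈ wedge A L) (k : ℕ) :
    (parabolicMap a m)^[k] (v * rootBranch m x) =
      v * rootBranch m ((reciprocalStep m)^[k] x) := by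
  induction k with
  | zero => rfl
  | succ k ih =>
    have hk := h.iterate_mem hx k
    rw [Function.iterate_succ_apply', Function.iterate_succ_apply', ih, parabolicMap_mul hm hv,
      h.rootBranch_step _ hk,
      rootBranch_pow hm (Complex.slitPlane_ne_zero (wedge_subset_slitPlane h.pos.le hk))]

lemma natCast_rpow_ne_zero {k : ℕ} (hk : k ≠ 0) (r : ℝ) : (((k : ℝ) ^ r : ℝ) : ℂ) ≠ 0 :=
  Complex.ofReal_ne_zero.2 (Real.rpow_pos_of_pos (Nat.cast_pos.2 (Nat.pos_of_ne_zero hk)) r).ne'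

/-- Because v/k^(1/m) tends to 0, the asymptotic equivalence already forces convergence to 0. -/
lemma tendsToZeroFrom_iff (hm : m ≠ 0) (hv0 : v ≠ 0) {f : ℂ → ℂ} {z : ℂ} :
    TendsToZeroFrom f m v z ↔
      Tendsto (fun k : ℕ => f^[k] z / v * (((k : ℝ) ^ (1 / (m : ℝ)) : ℝ) : ℂ)) atTop (𝓝 1) := by
  have hne : ∀ᶠ k : ℕ in atTop, v / (((k : ℝ) ^ (1 / (m : ℝ)) : ℝ) : ℂ) ≠ 0 := by
    filter_upwards [eventually_ne_atTop 0] with k hk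
    exact div_ne_zero hv0 (natCast_rpow_ne_zero hk _)
  have hfun : ((fun k : ℕ => f^[k] z) / fun k : ℕ => v / (((k : ℝ) ^ (1 / (m : ℝ)) : ℝ) : ℂ)) =
      fun k : ℕ => f^[k] z / v * (((k : ℝ) ^ (1 / (m : ℝ)) : ℝ) : ℂ) := by
    ext k
    simp only [Pi.div_apply]
    rw [div_div_eq_mul_div, div_mul_eq_mul_div]
  rw [TendsToZeroFrom, isEquivalent_iff_tendsto_one hne, hfun, and_iff_right_iff_imp]
  intro h
  have hlim : Tendsto (fun k : ℕ => v / (((k : ℝ) ^ (1 / (m : ℝ)) : ℝ) : ℂ)) atTop (𝓝 0) := by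
    have h1 : Tendsto (fun k : ℕ => (k : ℝ) ^ (1 / (m : ℝ))) atTop atTop :=
      (tendsto_rpow_atTop (by positivity)).comp tendsto_natCast_atTop_atTop
    have h2 := (Complex.continuous_ofReal.tendsto 0).comp h1.inv_tendsto_atTop
    have h3 := h2.const_mul v
    simpa [div_eq_mul_inv, Function.comp_def] using h3
  have h4 : IsEquivalent atTop (fun k : ℕ => f^[k] z)
      (fun k : ℕ => v / (((k : ℝ) ^ (1 / (m : ℝ)) : ℝ) : ℂ)) := by
    rw [isEquivalent_iff_tendsto_one hne, hfun]
    exact h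
  exact h4.symm.tendsto_nhds hlim

/-- The image of a translation wedge lies in the parabolic basin. -/
lemma mul_rootBranch_mem_parabolicBasin (hm : m ≠ 0) (hv : IsAttractionVector a m v) {A L : ℝ}
    (h : IsTranslationWedge m A L) {x : ℂ} (hx : x ∈ wedge A L) :
    v * rootBranch m x ∈ parabolicBasin (parabolicMap a m) m v := by
  have hv0 := hv.ne_zero hm
  rw [parabolicBasin, mem_ofPred_eq, tendsToZeroFrom_iff hm hv0]
  have h1 : Tendsto (fun k : ℕ => rootBranch m ((reciprocalStep m)^[k] x / k)) atTop (𝓝 1) := by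
    have h2 := (continuousOn_rootBranch (m := m)).continuousAt
      (Complex.isOpen_slitPlane.mem_nhds Complex.one_mem_slitPlane)
    have h3 := h2.tendsto.comp (h.tendsto_iterate_div hm hx)
    rwa [rootBranch_one] at h3
  refine h1.congr' ?_
  filter_upwards [eventually_ne_atTop 0] with k hk
  have hk' : (k : ℂ) ≠ 0 := Nat.cast_ne_zero.2 hk
  have hxk : (reciprocalStep m)^[k] x ≠ 0 :=
    Complex.slitPlane_ne_zero (wedge_subset_slitPlane h.pos.le (h.iterate_mem hx k))
  have h4 : (reciprocalStep m)^[k] x = ((k : ℝ) : ℂ) * ((reciprocalStep m)^[k] x / k) := by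
    push_cast
    rw [mul_div_cancel₀ _ hk']
  rw [parabolicMap_iterate_rootBranch hm hv h hx, mul_div_cancel_left₀ _ hv0]
  conv_rhs => rw [h4]
  rw [rootBranch_ofReal_mul _ (Nat.cast_pos.2 (Nat.pos_of_ne_zero hk)) (div_ne_zero hxk hk'),
    div_mul_cancel₀ _ (natCast_rpow_ne_zero hk _)]

/-- Every orbit in the basin enters the image of each translation wedge. -/
lemma eventually_mem_image_wedge (hm : m ≠ 0) (hv0 : v ≠ 0) {A L : ℝ}
    (hA : 0 ≤ A) {f : ℂ → ℂ} {z : ℂ} (hz : TendsToZeroFrom f m v z) :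
    ∀ᶠ k : ℕ in atTop, f^[k] z ∈ (fun x => v * rootBranch m x) '' wedge A L := by
  rw [tendsToZeroFrom_iff hm hv0] at hz
  set c : ℕ → ℂ := fun k => f^[k] z / v * (((k : ℝ) ^ (1 / (m : ℝ)) : ℝ) : ℂ) with hc
  have hd : Tendsto (fun k => ((c k ^ m)⁻¹).re) atTop (𝓝 1) := by
    have h1 : Tendsto (fun k => (c k ^ m)⁻¹) atTop (𝓝 1) := by
      simpa using (hz.pow m).inv₀ (by simp)
    exact (Complex.continuous_re.tendsto (1 : ℂ)).comp h1
  have hbig : ∀ᶠ k : ℕ in atTop, 2 * L < k :=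
    tendsto_natCast_atTop_atTop.eventually_gt_atTop _
  filter_upwards [hz.eventually (eventually_rootBranch_inv_pow hm),
    hd.eventually_const_lt (show (1 / 2 : ℝ) < 1 by norm_num), hbig, eventually_ne_atTop 0]
    with k h1 h2 h3 h4
  have hk : (0 : ℝ) < k := Nat.cast_pos.2 (Nat.pos_of_ne_zero h4)
  have hne : (c k ^ m)⁻¹ ≠ 0 := fun h => by rw [h] at h2; norm_num at h2
  -- With f^k(z) = v c k^(-1/m) and c near 1, the coordinate is k c^(-m), of real part above k/2;
  -- near 1 the principal root recovers c.
  refine ⟨((k : ℝ) : ℂ) * (c k ^ m)⁻¹, ?_, ?_⟩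
  · change L < _ + _
    rw [Complex.re_ofReal_mul]
    have := mul_nonneg hA (abs_nonneg ((((k : ℝ) : ℂ) * (c k ^ m)⁻¹).im))
    nlinarith
  · simp only
    rw [rootBranch_ofReal_mul _ hk hne, h1, hc]
    simp only
    rw [mul_div_cancel_right₀ _ (natCast_rpow_ne_zero h4 _), mul_div_cancel₀ _ hv0]

/-- The image is connected, lies in the basin, and meets Ω because an orbit starting in Ω stays
there and eventually enters the image. -/
lemma image_wedge_subset_immediateBasin (hm : m ≠ 0) (hv : IsAttractionVector a m v) {A L : ℝ}
    (h : IsTranslationWedge m A L) {Ω : Set ℂ}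
    (hΩ : IsImmediateBasin (parabolicMap a m) m v Ω) :
    (fun x => v * rootBranch m x) '' wedge A L ⊆ Ω := by
  obtain ⟨⟨z, hz, hΩz⟩, hmaps⟩ := hΩ
  have hzΩ : z ∈ Ω := hΩz ▸ mem_connectedComponentIn hz
  obtain ⟨k, hk⟩ := (eventually_mem_image_wedge (A := A) (L := L) hm (hv.ne_zero hm)
    h.nonneg hz).exists
  have hkΩ : (parabolicMap a m)^[k] z ∈ Ω := hmaps.iterate k hzΩ
  have hpre : IsPreconnected ((fun x => v * rootBranch m x) '' wedge A L) :=
    (isPreconnected_wedge h.nonneg).image _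
      (continuousOn_const.mul (continuousOn_rootBranch.mono (wedge_subset_slitPlane h.pos.le)))
  rw [hΩz] at hkΩ ⊢
  rw [connectedComponentIn_eq hkΩ]
  refine hpre.subset_connectedComponentIn hk ?_
  rintro _ ⟨x, hx, rfl⟩
  exact mul_rootBranch_mem_parabolicBasin hm hv h hx

/-- The basin avoids the repelling rays. -/
lemma pow_mem_slitPlane_of_mem_parabolicBasin (hm : m ≠ 0) (hv : IsAttractionVector a m v) {z : ℂ}
    (hz : z ∈ parabolicBasin (parabolicMap a m) m v) : (z / v) ^ m ∈ Complex.slitPlane := by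
  have hv0 := hv.ne_zero hm
  by_contra hns
  obtain ⟨L, hL⟩ := exists_isTranslationWedge hm (le_refl (0 : ℝ))
  obtain ⟨k, x, hx, hxz⟩ := (eventually_mem_image_wedge (A := 0) (L := L) hm hv0 le_rfl hz).exists
  -- The half line (z/v)^m ≤ 0 is invariant, since -t goes to -t(1 + t/m)^m, whereas an orbit in the
  -- basin must reach the wedge, which lies over the slit plane.
  have hneg : ∀ k : ℕ, ∃ t : ℝ, 0 ≤ t ∧ ((parabolicMap a m)^[k] z / v) ^ m = ((-t : ℝ) : ℂ) := by
    intro k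
    induction k with
    | zero =>
      rw [Complex.mem_slitPlane_iff, not_or, not_lt, not_not] at hns
      refine ⟨-((z / v) ^ m).re, by linarith [hns.1], ?_⟩
      apply Complex.ext <;> simp [hns.2]
    | succ k ih =>
      obtain ⟨t, ht, htk⟩ := ih
      rw [Function.iterate_succ_apply']
      set w := (parabolicMap a m)^[k] z
      have h1 : parabolicMap a m w / v = w / v * (1 - (w / v) ^ m / m) := by
        conv_lhs => rw [← mul_div_cancel₀ w hv0]
        rw [parabolicMap_mul hm hv, mul_div_cancel_left₀ _ hv0]
      refine ⟨t * (1 + t / m) ^ m, by positivity, ?_⟩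
      rw [h1, mul_pow, htk]
      push_cast
      ring
  obtain ⟨t, ht, htk⟩ := hneg k
  have hxs := wedge_subset_slitPlane hL.pos.le hx
  rw [← hxz] at htk
  simp only at htk
  rw [mul_div_cancel_left₀ _ hv0, rootBranch_pow hm (Complex.slitPlane_ne_zero hxs),
    inv_eq_iff_eq_inv] at htk
  rw [htk, ← Complex.ofReal_inv, Complex.ofReal_mem_slitPlane, inv_pos] at hxs
  linarith

/-- The line spanned by `v` is invariant. -/
lemma exists_parabolicMap_iterate_real (hm : m ≠ 0) (hv : IsAttractionVector a m v) (s : ℝ)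
    (k : ℕ) : ∃ r : ℝ, (parabolicMap a m)^[k] (s * v) = r * v := by
  induction k with
  | zero => exact ⟨s, rfl⟩
  | succ k ih =>
    obtain ⟨r, hr⟩ := ih
    refine ⟨r * (1 - r ^ m / m), ?_⟩
    rw [Function.iterate_succ_apply', hr, mul_comm, parabolicMap_mul hm hv]
    push_cast
    ring

/-- Points with nonreal coordinate in a translation wedge are not in the grand orbit of a point
of the line spanned by `v`. -/
lemma notMem_grandOrbit (hm : m ≠ 0) (hv : IsAttractionVector a m v) {A L : ℝ}
    (h : IsTranslationWedge m A L) {w : ℂ} (hw : ((w / v) ^ m)⁻¹ ∈ wedge A L)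
    (him : (((w / v) ^ m)⁻¹).im ≠ 0) (s : ℝ) : w ∉ grandOrbit (parabolicMap a m) (s * v) := by
  intro hmem
  simp only [grandOrbit, mem_iUnion, mem_preimage, mem_singleton_iff] at hmem
  obtain ⟨l, k, hlk⟩ := hmem
  obtain ⟨r, hr⟩ := exists_parabolicMap_iterate_real hm hv s k
  have h1 := (parabolicMap_semiconj hm hv).iterate_right l w
  refine h.iterate_im_ne_zero hw him l ?_
  rw [← h1]
  simp only [hlk, hr]
  rw [mul_div_cancel_right₀ _ (hv.ne_zero hm)]
  norm_cast

end Basin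

/-! ### The half plane coordinate on the basin. -/

section HalfPlane

variable {m : ℕ} {a v : ℂ}

/-- The coordinate `(z/v)^(m/2)`, which maps the basin into the right half plane. -/
noncomputable def halfPlaneCoord (m : ℕ) (v z : ℂ) : ℂ := ((z / v) ^ m) ^ (2⁻¹ : ℂ)

lemma halfPlaneCoord_sq (z : ℂ) : halfPlaneCoord m v z ^ 2 = (z / v) ^ m := by
  simp [halfPlaneCoord]

lemma halfPlaneCoord_re_pos {z : ℂ} (hz : (z / v) ^ m ∈ Complex.slitPlane) :
    0 < (halfPlaneCoord m v z).re := by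
  rw [halfPlaneCoord, Complex.cpow_def_of_ne_zero (Complex.slitPlane_ne_zero hz), Complex.exp_re]
  refine mul_pos (Real.exp_pos _) (Real.cos_pos_of_mem_Ioo ?_)
  have h1 : (Complex.log ((z / v) ^ m) * 2⁻¹).im = ((z / v) ^ m).arg / 2 := by
    have : (2⁻¹ : ℂ) = ((2⁻¹ : ℝ) : ℂ) := by push_cast; rfl
    rw [this, Complex.im_mul_ofReal, Complex.log_im, ← div_eq_mul_inv]
  rw [h1]
  have h2 := Complex.neg_pi_lt_arg ((z / v) ^ m)
  have h3 := lt_of_le_of_ne (Complex.arg_le_pi ((z / v) ^ m)) (Complex.slitPlane_arg_ne_pi hz)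
  constructor <;> linarith

lemma contDiffAt_halfPlaneCoord {z : ℂ} (hz : (z / v) ^ m ∈ Complex.slitPlane) :
    ContDiffAt ℂ 1 (halfPlaneCoord m v) z := by
  have h1 : AnalyticAt ℂ (halfPlaneCoord m v) z := by
    unfold halfPlaneCoord
    exact AnalyticAt.cpow ((analyticAt_id.div_const).pow m) analyticAt_const hz
  exact h1.contDiffAt

/-- A point of a half plane with bounded slope and small real part corresponds to a point of the
wedge. -/
lemma inv_sq_mem_wedge {A L : ℝ} {g : ℂ} (hg : 0 < g.re) (h0 : 0 < g.im)
    (hA : g.im ≤ A * g.re) (hL : 0 < L) (hsmall : g.re ^ 2 * (1 + A ^ 2) * L < 1) :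
    (g ^ 2)⁻¹ ∈ wedge A L ∧ ((g ^ 2)⁻¹).im ≠ 0 := by
  have hN : 0 < g.re ^ 2 + g.im ^ 2 := by positivity
  have hnorm : Complex.normSq (g ^ 2) = (g.re ^ 2 + g.im ^ 2) ^ 2 := by
    rw [map_pow, Complex.normSq_apply]; ring
  have hre : ((g ^ 2)⁻¹).re = (g.re ^ 2 - g.im ^ 2) / (g.re ^ 2 + g.im ^ 2) ^ 2 := by
    rw [Complex.inv_re, hnorm, pow_two g, Complex.mul_re]; ring
  have him : ((g ^ 2)⁻¹).im = -(2 * g.re * g.im / (g.re ^ 2 + g.im ^ 2) ^ 2) := by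
    rw [Complex.inv_im, hnorm, pow_two g, Complex.mul_im]; ring
  have hpos : 0 < 2 * g.re * g.im / (g.re ^ 2 + g.im ^ 2) ^ 2 := by positivity
  refine ⟨?_, by rw [him]; linarith⟩
  change L < _ + _
  rw [hre, him, abs_neg, abs_of_pos hpos, mul_div_assoc', ← add_div, lt_div_iff₀ (by positivity)]
  have h1 : g.re ^ 2 + g.im ^ 2 ≤ g.re ^ 2 * (1 + A ^ 2) := by
    nlinarith [mul_self_le_mul_self h0.le hA]
  have h2 : L * (g.re ^ 2 + g.im ^ 2) < 1 := by
    nlinarith [mul_le_mul_of_nonneg_left h1 hL.le]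
  -- The difference of the two sides is 2 Im g (A Re g - Im g), so the slope bound gives Re x + A|Im
  -- x| ≥ 1/|g|² for x = g^(-2).
  have h3 : g.re ^ 2 + g.im ^ 2 ≤ g.re ^ 2 - g.im ^ 2 + A * (2 * g.re * g.im) := by
    nlinarith [mul_le_mul_of_nonneg_left hA h0.le]
  nlinarith [mul_lt_mul_of_pos_right h2 hN]

end HalfPlane

/-! ### Choice of z₀ and conclusion. -/

theorem theoremB (m : ℕ) (hm : 1 ≤ m) (a : ℂ) (ha : a ≠ 0)
    (v : ℂ) (hv : IsAttractionVector a m v)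
    (Ω : Set ℂ) (hΩ : IsImmediateBasin (parabolicMap a m) m v Ω)
    (P : Set ℂ) (hP : IsAttractingPetal (parabolicMap a m) m v P)
    (C : ℝ) (hC : 0 < C)
    (q : ℂ) (hqv : ∃ s : ℝ, 0 < s ∧ q = (s : ℂ) * v) (hqP : q ∈ P) :
    ∃ z₀ ∈ Ω, ∀ q' ∈ grandOrbit (parabolicMap a m) q ∩ Ω,
      ENNReal.ofReal C ≤ kobayashiDist Ω z₀ q' := by
  have hm0 : m ≠ 0 := by omega
  have hv0 := hv.ne_zero hm0
  obtain ⟨s, -, rfl⟩ := hqv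
  have hslit : ∀ z ∈ Ω, (z / v) ^ m ∈ Complex.slitPlane := fun z hz => by
    obtain ⟨⟨z', -, hz'⟩, -⟩ := hΩ
    exact pow_mem_slitPlane_of_mem_parabolicBasin hm0 hv
      (connectedComponentIn_subset _ _ (hz' ▸ hz))
  -- The arsinh of the slope starts at 2C + 1 and moves by at most 2C, so it stays in [1, 4C + 1]:
  -- the lower end keeps Im G positive, the upper end fixes the wedge.
  set A := Real.sinh (4 * C + 1) with hA_def
  set T := Real.sinh (2 * C + 1) with hT_def
  have hT : 0 < T := Real.sinh_pos_iff.2 (by linarith)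
  have hTA : T ≤ A := Real.sinh_le_sinh.2 (by linarith)
  have hA : 0 < A := hT.trans_le hTA
  obtain ⟨L, hL⟩ := exists_isTranslationWedge hm0 hA.le
  have hLpos := hL.pos
  -- The factor exp(2C) allows for the growth of Re G along a curve of length below C.
  obtain ⟨X, hX, hXL⟩ : ∃ X : ℝ, 0 < X ∧ (X * Real.exp (2 * C)) ^ 2 * (1 + A ^ 2) * L < 1 := by
    have h1 : Tendsto (fun X : ℝ => (X * Real.exp (2 * C)) ^ 2 * (1 + A ^ 2) * L) (𝓝[>] 0)
        (𝓝 0) := by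
      have : Continuous fun X : ℝ => (X * Real.exp (2 * C)) ^ 2 * (1 + A ^ 2) * L := by fun_prop
      simpa using (this.tendsto 0).mono_left nhdsWithin_le_nhds
    exact (eventually_mem_nhdsWithin.and (h1.eventually_lt_const one_pos)).exists
  set g₀ : ℂ := ⟨X, T * X⟩ with hg₀
  have hexp : 1 ≤ Real.exp (2 * C) := Real.one_le_exp (by linarith)
  have hg₀w := (inv_sq_mem_wedge (A := A) (L := L) (g := g₀) hX (by positivity)
    (mul_le_mul_of_nonneg_right hTA hX.le) hLpos (by
      refine lt_of_le_of_lt ?_ hXL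
      gcongr
      exact le_mul_of_one_le_right hX.le hexp)).1
  have hg₀ne : (g₀ ^ 2)⁻¹ ≠ 0 :=
    Complex.slitPlane_ne_zero (wedge_subset_slitPlane hLpos.le hg₀w)
  set z₀ := v * rootBranch m (g₀ ^ 2)⁻¹ with hz₀
  have hz₀G : halfPlaneCoord m v z₀ = g₀ := by
    rw [halfPlaneCoord, hz₀, mul_div_cancel_left₀ _ hv0, rootBranch_pow hm0 hg₀ne, inv_inv,
      Complex.sq_cpow_two_inv hX]
  refine ⟨z₀, image_wedge_subset_immediateBasin hm0 hv hL hΩ ⟨_, hg₀w, rfl⟩, ?_⟩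
  rintro w ⟨hwq, hwΩ⟩
  refine le_sInf ?_
  rintro _ ⟨γ, ⟨hγ, hγΩ, hγ0, rfl⟩, rfl⟩
  by_contra! hlt
  obtain ⟨hlog, hars⟩ := variation_le_kobayashiLength (G := halfPlaneCoord m v)
    (fun z hz => (contDiffAt_halfPlaneCoord (hslit z hz)).differentiableAt one_ne_zero)
    (fun z hz => ((contDiffAt_halfPlaneCoord (hslit z hz)).restrict_scalars ℝ).contDiffWithinAt)
    (fun z hz => halfPlaneCoord_re_pos (hslit z hz)) hγ hγΩ
  have hbound : ∀ {d : ℝ}, ‖d‖ₑ ≤ 2 * kobayashiLength Ω γ → |d| ≤ 2 * C := fun {d} hd => by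
    have h1 : ENNReal.ofReal |d| ≤ ENNReal.ofReal (2 * C) := by
      rw [← Real.norm_eq_abs, ofReal_norm, ENNReal.ofReal_mul zero_le_two]
      refine hd.trans ?_
      gcongr
      norm_num
    exact (ENNReal.ofReal_le_ofReal_iff (by positivity)).1 h1
  have hlog' := abs_le.1 (hbound hlog)
  have hars' := abs_le.1 (hbound hars)
  rw [hγ0, hz₀G] at hlog' hars'
  set g := halfPlaneCoord m v (γ 1) with hg
  have hgre : 0 < g.re := halfPlaneCoord_re_pos (hslit _ hwΩ)
  have hg₀T : Real.arsinh (g₀.im / g₀.re) = 2 * C + 1 := by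
    change Real.arsinh (T * X / X) = _
    rw [mul_div_cancel_right₀ _ hX.ne', hT_def, Real.arsinh_sinh]
  rw [hg₀T] at hars'
  have hgim : 0 < g.im := by
    have h1 : 0 < Real.arsinh (g.im / g.re) := by linarith [hars'.1]
    exact (div_pos_iff_of_pos_right hgre).1 (Real.arsinh_pos_iff.1 h1)
  have hgA : g.im ≤ A * g.re := by
    rw [← div_le_iff₀ hgre, hA_def, ← Real.sinh_arsinh (g.im / g.re), Real.sinh_le_sinh]
    linarith [hars'.2]
  have hgX : g.re ≤ X * Real.exp (2 * C) := by
    have h1 : Real.log g.re ≤ Real.log X + 2 * C := by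
      have : Real.log g₀.re = Real.log X := rfl
      linarith [hlog'.2]
    calc g.re = Real.exp (Real.log g.re) := (Real.exp_log hgre).symm
      _ ≤ Real.exp (Real.log X + 2 * C) := Real.exp_le_exp.2 h1
      _ = _ := by rw [Real.exp_add, Real.exp_log hX]
  obtain ⟨hmem, him⟩ := inv_sq_mem_wedge hgre hgim hgA hLpos (by
    refine lt_of_le_of_lt ?_ hXL
    gcongr)
  rw [hg, halfPlaneCoord_sq] at hmem him
  exact notMem_grandOrbit hm0 hv hL hmem him s hwq
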